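/- Let $\Phi$ be a field, let $r>1$ be an integer, and let $R$ be either the free associative algebra $\Phi\langle x_1,\dots,x_r\rangle$ or the group algebra $\Phi[F_r]$ of the free group $F_r$ on $x_1,\dots,x_r$. Let $\Delta$ be the augmentation ideal of $R$, that is, the kernel of the algebra homomorphism $R\to\Phi$ sending every $x_i$ to $0$ in the first case and every $x_i$ to $1$ in the second. All modules are right modules and dimensions are over $\Phi$. An $R$-module $M$ is called *nil* if for all $x\in M$ and $u\in\Delta$ there is $n$ with $xu^n=0$; it is called *large* if it has a submodule of finite codimension that admits a surjective $R$-homomorphism onto $R$; it is called *residually finite-dimensional* if every nonzero element of $M$ has nonzero image in some finite-dimensional quotient module of $M$. Let $M$ be an $R$-module given by $p$ generators and $q$ defining relations, i.e. $M\cong F/N$ with $F$ a free $R$-module with a basis of $p$ elements and $N$ a submodule generated by $q$ elements, where $p,q$ are non-negative integers with $q<p$. Then $M$ has a quotient module $\overline{M}$ that is an infinite-dimensional, finitely generated nil $R$-module. Moreover, $\overline{M}$ can be chosen so that it is, compatibly with the projections from $M$, the direct limit of a sequence $M=M_0\twoheadrightarrow M_1\twoheadrightarrow M_2\twoheadrightarrow\cdots$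 of large quotient modules of $M$ with surjective structure homomorphisms, and so that $\overline{M}$ has a quotient module $\widetilde{M}$ that is still infinite-dimensional and nil, and also residually finite-dimensional. -/

import Mathlib

/-! Right modules over `R` are modules over `Rᵐᵒᵖ`; the product `x a` is `MulOpposite.op a • x`. -/

/-- `R`, with the augmentation `ε : R → Φ`, is the free associative algebra over `Φ` of rank `r`:
it is identified with `Φ⟨x₁, …, xᵣ⟩` so that `ε` is the map sending every `xᵢ` to `0`. -/
def IsFreeAssociativeAlgebra {Φ : Type*} [Field Φ] (r : ℕ) {R : Type*} [Ring R] [Algebra Φ R]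
    (ε : R →ₐ[Φ] Φ) : Prop :=
  ∃ e : FreeAlgebra Φ (Fin r) ≃ₐ[Φ] R,
    ε.comp (e : FreeAlgebra Φ (Fin r) →ₐ[Φ] R) = FreeAlgebra.lift Φ (fun _ : Fin r => (0 : Φ))

/-- `R`, with the augmentation `ε : R → Φ`, is the group algebra over `Φ` of the free group of
rank `r`: it is identified with `Φ[F(x₁, …, xᵣ)]` so that `ε` sends every group element to `1`. -/
def IsFreeGroupAlgebra {Φ : Type*} [Field Φ] (r : ℕ) {R : Type*} [Ring R] [Algebra Φ R]
    (ε : R →ₐ[Φ] Φ) : Prop :=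
  ∃ e : MonoidAlgebra Φ (FreeGroup (Fin r)) ≃ₐ[Φ] R,
    ε.comp (e : MonoidAlgebra Φ (FreeGroup (Fin r)) →ₐ[Φ] R) =
      MonoidAlgebra.lift Φ Φ (FreeGroup (Fin r)) (1 : FreeGroup (Fin r) →* Φ)

/-- The right `R`-module `M` is given by `p` generators and `q` defining relations: it is the
quotient of a free right module with a basis of `p` elements by the submodule generated by
`v₁, …, v_q`. -/
def HasPresentation (R : Type*) [Ring R] (M : Type*) [AddCommGroup M] [Module Rᵐᵒᵖ M]
    (p q : ℕ) : Prop :=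
  ∃ (π : (Fin p → R) →ₗ[Rᵐᵒᵖ] M) (v : Fin q → (Fin p → R)),
    Function.Surjective π ∧ LinearMap.ker π = Submodule.span Rᵐᵒᵖ (Set.range v)

/-- A right module is large if some submodule of finite codimension admits a surjective
homomorphism onto the right module `R`. -/
def IsLargeModule (Φ : Type*) [Field Φ] (R : Type*) [Ring R] [Algebra Φ R]
    (M : Type*) [AddCommGroup M] [Module Φ M] [Module Rᵐᵒᵖ M] [IsScalarTower Φ Rᵐᵒᵖ M] : Prop :=
  ∃ N : Submodule Rᵐᵒᵖ M, FiniteDimensional Φ (M ⧸ N) ∧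
    ∃ f : N →ₗ[Rᵐᵒᵖ] R, Function.Surjective f

/-- A right module is nil if for all `x ∈ M` and `u` in the augmentation ideal `ker ε` there is
`n` with `x uⁿ = 0`. -/
def IsNilModule {Φ : Type*} [Field Φ] {R : Type*} [Ring R] [Algebra Φ R] (ε : R →ₐ[Φ] Φ)
    (M : Type*) [AddCommGroup M] [Module Rᵐᵒᵖ M] : Prop :=
  ∀ (x : M) (u : R), u ∈ RingHom.ker ε → ∃ n : ℕ, MulOpposite.op (u ^ n) • x = 0

/-- A right module is residually finite-dimensional if every nonzero element stays nonzero in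
some finite-dimensional quotient module. -/
def IsResiduallyFiniteDimensional (Φ : Type*) [Field Φ] (R : Type*) [Ring R] [Algebra Φ R]
    (M : Type*) [AddCommGroup M] [Module Φ M] [Module Rᵐᵒᵖ M] [IsScalarTower Φ Rᵐᵒᵖ M] : Prop :=
  ∀ x : M, x ≠ 0 → ∃ N : Submodule Rᵐᵒᵖ M, FiniteDimensional Φ (M ⧸ N) ∧ x ∉ N

/-- The structure maps `M / N i → M / N j`, for `i ≤ j`, of the direct system of quotients of `M`
given by an ascending chain of submodules `N 0 ≤ N 1 ≤ …`. -/
def quotientSystem {R : Type*} [Ring R] {M : Type*} [AddCommGroup M] [Module Rᵐᵒᵖ M]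
    (N : ℕ →o Submodule Rᵐᵒᵖ M) (i j : ℕ) (h : i ≤ j) : (M ⧸ N i) →ₗ[Rᵐᵒᵖ] (M ⧸ N j) :=
  Submodule.factor (N.monotone h)

/-- The quotient `M / K` is the direct limit of the large modules
`M = M / N 0 ↠ M / N 1 ↠ M / N 2 ↠ …`, compatibly with the projections from `M`. -/
def IsDirectLimitOfLargeQuotients (Φ : Type*) [Field Φ] {R : Type*} [Ring R] [Algebra Φ R]
    {M : Type*} [AddCommGroup M] [Module Φ M] [Module Rᵐᵒᵖ M] [IsScalarTower Φ Rᵐᵒᵖ M]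
    (K : Submodule Rᵐᵒᵖ M) : Prop :=
  ∃ N : ℕ →o Submodule Rᵐᵒᵖ M, N 0 = ⊥ ∧
    (∀ t, IsLargeModule Φ R (M ⧸ N t)) ∧
    (∀ i j (h : i ≤ j), Function.Surjective (quotientSystem N i j h)) ∧
    ∃ e : Module.DirectLimit (fun t => M ⧸ N t) (quotientSystem N) ≃ₗ[Rᵐᵒᵖ] (M ⧸ K),
      ∀ (t : ℕ) (x : M),
        e (Module.DirectLimit.of Rᵐᵒᵖ ℕ (fun t => M ⧸ N t) (quotientSystem N) t
          (Submodule.Quotient.mk x)) = Submodule.Quotient.mk x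

/-! The argument is of Golod–Shafarevich type. Fox derivatives give a filtration of `R` by two-sided
ideals `I_n` with `I_m I_n ≤ I_(m+n)`, whose codimensions satisfy `c_0 = 0` and `c_(n+1) = 1 + r
c_n`. Let `M_n` be the image in `M` of the vectors with entries in `I_n`. A relation costs at most
`c_n` dimensions modulo level `n`, so `q < p` gives `dim M/M_n ≥ c_n`. A relation lying in `M_m`
costs only `c_(n-m) ≤ c_n / r^m`.

If `E ≤ M` and `V ≤ Δ` are finite-dimensional, expanding `u^m` in coordinates shows that
polynomially many relations in `M_m` kill all `x u^m` with `x ∈ E` and `u ∈ V`. As `r > 1`, their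
total cost is at most `δ c_n` for large `m` (`exists_nil_step`). Exhausting `M` and `Δ` with costs
summing to at most `1/2` gives finitely generated `N_0 ≤ N_1 ≤ …` with nil limit `M/K` and `dim
M/(N_t + M_n) ≥ c_n/2`. Step `t` adds relations only inside `N_t + M_t`, so `K + M_n = N_n + M_n`;
hence `M/⋂(K + M_n)` is infinite-dimensional, and it is residually finite-dimensional.

Each `M/N_t` is finitely presented and infinite-dimensional, hence large
(`isLargeModule_of_finitelyPresented`): the generators act partially on a finite-dimensional
subspace `A` in which all relations can be checked, and freeness extends this to an action on `A ×
R` that maps a vector escaping from `A` into the free part. -/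

/-- Fox derivatives on an augmented algebra, relative to elements `y₁, …, yᵣ` of the augmentation
ideal. -/
structure FoxDerivatives {Φ R : Type*} [Field Φ] [Ring R] [Algebra Φ R] (ε : R →ₐ[Φ] Φ)
    (r : ℕ) where
  /-- The derivatives. -/
  D : Fin r → R →ₗ[Φ] R
  /-- The dual elements. -/
  y : Fin r → R
  D_mul : ∀ i s t, D i (s * t) = D i s * t + ε s • D i t
  D_y : ∀ i j, D i (y j) = if i = j then 1 else 0
  ε_y : ∀ i, ε (y i) = 0

/-! ### The filtration of the algebra and its codimensions -/

namespace FoxDerivatives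

variable {Φ R : Type*} [Field Φ] [Ring R] [Algebra Φ R] {ε : R →ₐ[Φ] Φ} {r : ℕ}
  (X : FoxDerivatives ε r)

/-- The elements all of whose iterated Fox derivatives of order less than `n` have
augmentation `0`. -/
def filtration : ℕ → Submodule Φ R
  | 0 => ⊤
  | n + 1 => LinearMap.ker ε.toLinearMap ⊓ ⨅ i, (filtration n).comap (X.D i)

lemma mem_filtration_succ {n : ℕ} {s : R} :
    s ∈ X.filtration (n + 1) ↔ ε s = 0 ∧ ∀ i, X.D i s ∈ X.filtration n := by
  simp [filtration]

lemma mem_filtration_zero (s : R) : s ∈ X.filtration 0 := by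
  simp [filtration]

lemma mem_filtration_one {s : R} : s ∈ X.filtration 1 ↔ ε s = 0 := by
  simp [mem_filtration_succ, mem_filtration_zero]

lemma filtration_antitone : Antitone X.filtration := by
  refine antitone_nat_of_succ_le fun n => ?_
  induction n with
  | zero => exact fun s _ => X.mem_filtration_zero s
  | succ n ih =>
    intro s hs
    rw [mem_filtration_succ] at hs ⊢
    exact ⟨hs.1, fun i => ih (hs.2 i)⟩

lemma mul_mem_filtration_right {n : ℕ} {s : R} (hs : s ∈ X.filtration n) (t : R) :
    s * t ∈ X.filtration n := by
  induction n generalizing s with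
  | zero => exact X.mem_filtration_zero _
  | succ n ih =>
    rw [mem_filtration_succ] at hs ⊢
    refine ⟨by simp [hs.1], fun i => ?_⟩
    rw [X.D_mul, hs.1, zero_smul, add_zero]
    exact ih (hs.2 i)

/-- The product rule gives the terms `D i s * t` and `ε s • D i t`. The first is handled by
induction because `t` also lies in the previous, larger term of the filtration. -/
lemma mul_mem_filtration_left {n : ℕ} (s : R) {t : R} (ht : t ∈ X.filtration n) :
    s * t ∈ X.filtration n := by
  induction n generalizing s t with
  | zero => exact X.mem_filtration_zero _
  | succ n ih =>
    have ht' := X.filtration_antitone n.le_succ ht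
    rw [mem_filtration_succ] at ht ⊢
    refine ⟨by simp [ht.1], fun i => ?_⟩
    rw [X.D_mul]
    exact add_mem (ih _ ht') (Submodule.smul_mem _ _ (ht.2 i))

lemma mul_mem_filtration {m n : ℕ} {s t : R} (hs : s ∈ X.filtration m)
    (ht : t ∈ X.filtration n) : s * t ∈ X.filtration (m + n) := by
  induction m generalizing s with
  | zero => simpa using X.mul_mem_filtration_left s ht
  | succ m ih =>
    rw [mem_filtration_succ] at hs
    rw [show m + 1 + n = m + n + 1 by omega, mem_filtration_succ]
    refine ⟨by simp [hs.1], fun i => ?_⟩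
    rw [X.D_mul, hs.1, zero_smul, add_zero]
    exact ih (hs.2 i)

lemma D_one (i : Fin r) : X.D i 1 = 0 := by
  simpa using X.D_mul i 1 1

/-- The map sending an element to its augmentation and its Fox derivatives modulo the `n`-th
term of the filtration. -/
def taylor (n : ℕ) : R →ₗ[Φ] Φ × (Fin r → R ⧸ X.filtration n) :=
  ε.toLinearMap.prod (LinearMap.pi fun i => (X.filtration n).mkQ ∘ₗ X.D i)

lemma ker_taylor (n : ℕ) : LinearMap.ker (X.taylor n) = X.filtration (n + 1) := by
  ext s
  simp [taylor, mem_filtration_succ, funext_iff, Submodule.Quotient.mk_eq_zero]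

lemma taylor_surjective (n : ℕ) : Function.Surjective (X.taylor n) := by
  rintro ⟨c, g⟩
  choose s hs using fun i => Submodule.mkQ_surjective (X.filtration n) (g i)
  -- A first-order Taylor expansion: the `i`-th derivative of `y j * s j` is `s i` for `j = i` and
  -- `0` otherwise, and constants have derivative `0`.
  refine ⟨algebraMap Φ R c + ∑ j, X.y j * s j, ?_⟩
  ext i
  · simp [taylor, X.ε_y]
  · simp [taylor, X.D_mul, X.D_y, X.ε_y, X.D_one, Algebra.algebraMap_eq_smul_one, ← hs]
    rw [Finset.sum_eq_single i (fun j _ h => by simp [h.symm]) (by simp), if_pos rfl]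

/-- The Taylor map identifies the quotients of the filtration. -/
noncomputable def taylorEquiv (n : ℕ) :
    (R ⧸ X.filtration (n + 1)) ≃ₗ[Φ] Φ × (Fin r → R ⧸ X.filtration n) :=
  (Submodule.quotEquivOfEq _ _ (X.ker_taylor n).symm).trans
    (LinearMap.quotKerEquivOfSurjective _ (X.taylor_surjective n))

instance finite_quotient_filtration (n : ℕ) : FiniteDimensional Φ (R ⧸ X.filtration n) := by
  induction n with
  | zero =>
    have : Subsingleton (R ⧸ X.filtration 0) :=
      Submodule.Quotient.subsingleton_iff.2 rfl
    infer_instance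
  | succ n ih => exact Module.Finite.equiv (X.taylorEquiv n).symm

/-- The codimension of the `n`-th term of the filtration. -/
noncomputable def codim (n : ℕ) : ℕ := Module.finrank Φ (R ⧸ X.filtration n)

lemma codim_zero : X.codim 0 = 0 := by
  have : Subsingleton (R ⧸ X.filtration 0) := Submodule.Quotient.subsingleton_iff.2 rfl
  exact Module.finrank_zero_of_subsingleton

lemma codim_succ (n : ℕ) : X.codim (n + 1) = 1 + r * X.codim n := by
  simp [codim, (X.taylorEquiv n).finrank_eq, Module.finrank_pi_fintype]

lemma codim_mul_pow_le (m d : ℕ) : X.codim m * r ^ d ≤ X.codim (m + d) := by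
  induction d with
  | zero => simp
  | succ d ih =>
    rw [← add_assoc, codim_succ, pow_succ, ← mul_assoc, mul_comm _ r]
    exact (Nat.mul_le_mul_left r ih).trans (Nat.le_add_left _ _)

/-- Truncated subtraction is harmless: for `d ≥ n` the left side vanishes, since the zeroth term is
all of `R`. -/
lemma codim_sub_mul_pow_le (n d : ℕ) : X.codim (n - d) * r ^ d ≤ X.codim n := by
  obtain h | h := le_total d n
  · simpa [h] using X.codim_mul_pow_le (n - d) d
  · simp [Nat.sub_eq_zero_of_le h, X.codim_zero]

lemma le_codim (hr : 0 < r) (n : ℕ) : n ≤ X.codim n := by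
  induction n with
  | zero => simp
  | succ n ih =>
    rw [codim_succ]
    nlinarith [Nat.mul_le_mul hr ih]

end FoxDerivatives

/-! ### Extension of partial actions, and largeness -/

/-- `R` has a finite set of generators such that every partial action of these generators on a
finite-dimensional subspace `A` of `M` that is not globally defined extends to an action of `R` on
`A × R`, where `R` is a submodule and some generator moves a vector of `A` out of `A`. -/
def ExtendsPartialActions (Φ R M : Type*) [Field Φ] [Ring R] [Algebra Φ R] [AddCommGroup M]
    [Module Φ M] [Module Rᵐᵒᵖ M] (L : Set R) : Prop :=
  ∀ A : Submodule Φ M, FiniteDimensional Φ A →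
    (∃ s ∈ L, ∃ a ∈ A, MulOpposite.op s • a ∉ A) →
    ∃ ρ : R →ₐ[Φ] (Module.End Φ (A × R))ᵐᵒᵖ,
      (∀ s ∈ L, ∀ a : A, MulOpposite.op s • (a : M) ∈ A →
        (((ρ s).unop (a, 0)).1 : M) = MulOpposite.op s • (a : M) ∧ ((ρ s).unop (a, 0)).2 = 0) ∧
      (∀ s ∈ L, ∀ t : R, (ρ s).unop (0, t) = (0, t * s)) ∧
      ∃ s, ∃ a : A, ((ρ s).unop (a, 0)).2 = 1

section

variable {Φ R : Type*} [Field Φ] [Ring R] [Algebra Φ R]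

/-- The `n`-th power is spanned by the words of length at most `n` in `L`; including `1` makes the
powers increase. -/
lemma exists_mem_pow_of_adjoin_eq_top {L : Set R} (hL : Algebra.adjoin Φ L = ⊤) (s : R) :
    ∃ n, s ∈ (1 ⊔ Submodule.span Φ L) ^ n := by
  have hs : s ∈ Algebra.adjoin Φ L := hL ▸ Algebra.mem_top
  have mono : Monotone fun n => (1 ⊔ Submodule.span Φ L) ^ n :=
    pow_right_monotone le_sup_left
  induction hs using Algebra.adjoin_induction with
  | mem x hx => exact ⟨1, by simpa using Submodule.mem_sup_right (Submodule.subset_span hx)⟩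
  | algebraMap c => exact ⟨0, by simp⟩
  | add x y _ _ hx hy =>
    obtain ⟨m, hm⟩ := hx
    obtain ⟨n, hn⟩ := hy
    exact ⟨max m n, add_mem (mono (le_max_left m n) hm) (mono (le_max_right m n) hn)⟩
  | mul x y _ _ hx hy =>
    obtain ⟨m, hm⟩ := hx
    obtain ⟨n, hn⟩ := hy
    exact ⟨m + n, pow_add (1 ⊔ Submodule.span Φ L) m n ▸ Submodule.mul_mem_mul hm hn⟩

lemma finite_one_sup_span_pow {L : Set R} (hL : L.Finite) (n : ℕ) :
    ((1 ⊔ Submodule.span Φ L) ^ n).FG := by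
  refine Submodule.FG.pow (Submodule.FG.sup ?_ (Submodule.fg_span hL)) n
  rw [Submodule.one_eq_span]
  exact Submodule.fg_span_singleton _

lemma unop_apply_zero_prod {A : Type*} [AddCommGroup A] [Module Φ A] {L : Set R}
    (hL : Algebra.adjoin Φ L = ⊤) {ρ : R →ₐ[Φ] (Module.End Φ (A × R))ᵐᵒᵖ}
    (hρ : ∀ s ∈ L, ∀ t : R, (ρ s).unop (0, t) = (0, t * s)) (s : R) :
    ∀ t : R, (ρ s).unop (0, t) = (0, t * s) := by
  have hs : s ∈ Algebra.adjoin Φ L := hL ▸ Algebra.mem_top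
  induction hs using Algebra.adjoin_induction with
  | mem x hx => exact hρ x hx
  | algebraMap c =>
    intro t
    simp [Algebra.algebraMap_eq_smul_one]
  | add x y _ _ hx hy =>
    intro t
    simp [hx, hy, mul_add]
  | mul x y _ _ hx hy =>
    intro t
    simp [hx, hy, mul_assoc]

variable {M : Type*} [AddCommGroup M] [Module Φ M] [Module Rᵐᵒᵖ M] [IsScalarTower Φ Rᵐᵒᵖ M]

lemma op_smul_mem_of_adjoin_eq_top {L : Set R} (hL : Algebra.adjoin Φ L = ⊤) {A : Submodule Φ M}
    (hA : ∀ s ∈ L, ∀ a ∈ A, MulOpposite.op s • a ∈ A) (s : R) :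
    ∀ a ∈ A, MulOpposite.op s • a ∈ A := by
  have hs : s ∈ Algebra.adjoin Φ L := hL ▸ Algebra.mem_top
  induction hs using Algebra.adjoin_induction with
  | mem x hx => exact hA x hx
  | algebraMap c =>
    intro a ha
    have := A.smul_mem c ha
    rwa [← smul_one_smul Rᵐᵒᵖ c a, ← MulOpposite.op_one, ← MulOpposite.op_smul,
      ← Algebra.algebraMap_eq_smul_one] at this
  | add x y _ _ hx hy =>
    intro a ha
    rw [MulOpposite.op_add, add_smul]
    exact add_mem (hx a ha) (hy a ha)
  | mul x y _ _ hx hy =>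
    intro a ha
    rw [MulOpposite.op_mul, mul_smul]
    exact hy _ (hx a ha)

/-- The image in `M` of the vectors with all coordinates in `W`. -/
def boxImage {p : ℕ} (π : (Fin p → R) →ₗ[Rᵐᵒᵖ] M) (W : Submodule Φ R) : Submodule Φ M :=
  (Submodule.pi Set.univ fun _ => W).map (π.restrictScalars Φ)

lemma mem_boxImage {p : ℕ} {π : (Fin p → R) →ₗ[Rᵐᵒᵖ] M} {W : Submodule Φ R} {f : Fin p → R}
    (hf : ∀ i, f i ∈ W) : π f ∈ boxImage π W :=
  ⟨f, by simpa [Submodule.mem_pi] using hf, rfl⟩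

lemma finite_boxImage {p : ℕ} (π : (Fin p → R) →ₗ[Rᵐᵒᵖ] M) {W : Submodule Φ R} (hW : W.FG) :
    FiniteDimensional Φ (boxImage π W) := by
  have : FiniteDimensional Φ W := Module.Finite.iff_fg.2 hW
  have h : boxImage π W ≤
      LinearMap.range ((π.restrictScalars Φ) ∘ₗ (LinearMap.pi fun i =>
        W.subtype ∘ₗ LinearMap.proj i : (Fin p → W) →ₗ[Φ] (Fin p → R))) := by
    rintro _ ⟨f, hf, rfl⟩
    exact ⟨fun i => ⟨f i, hf i (Set.mem_univ i)⟩, rfl⟩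
  exact Submodule.finiteDimensional_of_le h

lemma single_mul_eq_op_smul {p : ℕ} (i : Fin p) (s t : R) :
    (Pi.single i (s * t) : Fin p → R) = MulOpposite.op t • Pi.single i s := by
  ext j
  by_cases h : j = i
  · subst h; simp
  · simp [h]

/-- A finitely presented infinite-dimensional module is large. -/
theorem isLargeModule_of_finitelyPresented {p : ℕ} (π : (Fin p → R) →ₗ[Rᵐᵒᵖ] M)
    (hπ : Function.Surjective π) (hker : (LinearMap.ker π).FG) {L : Set R} (hLfin : L.Finite)
    (hL : Algebra.adjoin Φ L = ⊤) (hext : ExtendsPartialActions Φ R M L)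
    (hM : ¬ FiniteDimensional Φ M) : IsLargeModule Φ R M := by
  classical
  set W : Submodule Φ R := 1 ⊔ Submodule.span Φ L with hW
  have mono : Monotone fun n => W ^ n := pow_right_monotone le_sup_left
  obtain ⟨G, hG⟩ := hker
  choose deg hdeg using exists_mem_pow_of_adjoin_eq_top hL
  -- Words of length at most `d` express every entry of every relation, so all relations can be
  -- evaluated inside `A`.
  obtain ⟨d, hd⟩ : ∃ d, ∀ g ∈ G, ∀ i, g i ∈ W ^ d := by
    refine ⟨G.sup fun g => Finset.univ.sup fun i => deg (g i), fun g hg i => ?_⟩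
    refine mono ?_ (hdeg (g i))
    exact (Finset.le_sup (f := fun i => deg (g i)) (Finset.mem_univ i)).trans
      (Finset.le_sup (f := fun g : Fin p → R => Finset.univ.sup fun i => deg (g i)) hg)
  set A := boxImage π (W ^ d) with hA
  have hAfin : FiniteDimensional Φ A := finite_boxImage π (finite_one_sup_span_pow hLfin d)
  have hsingle : ∀ (i : Fin p) {k : ℕ}, k ≤ d → ∀ w ∈ W ^ k, π (Pi.single i w) ∈ A := by
    intro i k hk w hw
    refine mem_boxImage fun j => ?_
    by_cases h : j = i
    · subst h; simpa using mono hk hw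
    · simp [h]
  -- If `A` were stable under the generators of `R`, it would be a submodule containing the
  -- generators of `M`, so `M = A` would be finite-dimensional.
  by_cases hclosed : ∀ s ∈ L, ∀ a ∈ A, MulOpposite.op s • a ∈ A
  · refine absurd ?_ hM
    have htop : A = ⊤ := by
      refine eq_top_iff.2 fun m _ => ?_
      obtain ⟨f, rfl⟩ := hπ m
      rw [← Finset.univ_sum_single f, map_sum]
      refine sum_mem fun i _ => ?_
      rw [← one_mul (f i), single_mul_eq_op_smul, map_smul]
      exact op_smul_mem_of_adjoin_eq_top hL hclosed _ _
        (hsingle i (Nat.zero_le d) 1 (by rw [pow_zero]; exact Submodule.one_le.1 le_rfl))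
    rw [htop] at hAfin
    exact Module.Finite.equiv (Submodule.topEquiv (R := Φ) (M := M))
  push Not at hclosed
  obtain ⟨ρ, hρA, hρR, s₀, a₀, h₀⟩ := hext A hAfin hclosed
  have hρR' := unop_apply_zero_prod hL hρR
  have he : ∀ i, π (Pi.single i 1) ∈ A := fun i =>
    hsingle i (Nat.zero_le d) 1 (by rw [pow_zero]; exact Submodule.one_le.1 le_rfl)
  let g' : (Fin p → R) →ₗ[Φ] A × R :=
    { toFun := fun f => ∑ i, (ρ (f i)).unop (⟨π (Pi.single i 1), he i⟩, 0)
      map_add' := fun f f' => by simp [Finset.sum_add_distrib]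
      map_smul' := fun c f => by simp [Finset.smul_sum] }
  have hg'smul : ∀ (f : Fin p → R) (s : R), g' (MulOpposite.op s • f) = (ρ s).unop (g' f) := by
    intro f s
    simp [g', map_sum]
  -- Up to length `d` every prefix of a word stays in `A`, where the new action agrees with the old
  -- one. Hence the relations of `M` hold in `A × R`.
  have hword : ∀ (i : Fin p) (k : ℕ), k ≤ d → ∀ w ∈ W ^ k,
      (((ρ w).unop (⟨π (Pi.single i 1), he i⟩, 0)).1 : M) = π (Pi.single i w) ∧
      ((ρ w).unop (⟨π (Pi.single i 1), he i⟩, 0)).2 = 0 := by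
    intro i k
    induction k with
    | zero =>
      intro _ w hw
      obtain ⟨c, rfl⟩ := Submodule.mem_one.1 (by simpa using hw)
      simp only [Algebra.algebraMap_eq_smul_one, Pi.single_smul]
      rw [LinearMap.map_smul_of_tower]
      simp
    | succ k ih =>
      intro hk w hw
      rw [pow_succ] at hw
      induction hw using Submodule.mul_induction_on' with
      | mem_mul_mem v hv s hs =>
        obtain ⟨h1, h2⟩ := ih (by omega) v hv
        have hv' : (ρ v).unop (⟨π (Pi.single i 1), he i⟩, 0) =
            (⟨π (Pi.single i v), hsingle i (by omega) v hv⟩, 0) :=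
          Prod.ext (Subtype.ext h1) h2
        simp only [map_mul, MulOpposite.unop_mul, Module.End.mul_apply, hv',
          single_mul_eq_op_smul, map_smul]
        have hs' : s ∈ Submodule.span Φ ({1} ∪ L) := by
          rwa [Submodule.span_union, ← Submodule.one_eq_span]
        clear hs
        induction hs' using Submodule.span_induction with
        | mem s hs =>
          obtain rfl | hs := hs
          · simp
          · refine hρA s hs ⟨π (Pi.single i v), _⟩ ?_
            rw [← map_smul, ← single_mul_eq_op_smul]
            refine hsingle i hk _ ?_
            rw [pow_succ]
            exact Submodule.mul_mem_mul hv
              (Submodule.mem_sup_right (Submodule.subset_span hs))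
        | zero => simp
        | add s t _ _ hs ht => simp [add_smul, hs, ht]
        | smul c s _ hs => simp [hs]
      | add v _ v' _ h h' => simp [Pi.single_add, h, h']
  have hg'A : ∀ f : Fin p → R, (∀ i, f i ∈ W ^ d) → ((g' f).1 : M) = π f ∧ (g' f).2 = 0 := by
    intro f hf
    constructor
    · conv_rhs => rw [← Finset.univ_sum_single f, map_sum]
      simp only [g', LinearMap.coe_mk, AddHom.coe_mk, Prod.fst_sum, AddSubmonoidClass.coe_finsetSum]
      exact Finset.sum_congr rfl fun i _ => (hword i d le_rfl _ (hf i)).1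
    · simp only [g', LinearMap.coe_mk, AddHom.coe_mk, Prod.snd_sum]
      exact Finset.sum_eq_zero fun i _ => (hword i d le_rfl _ (hf i)).2
  have hkerle : LinearMap.ker (π.restrictScalars Φ) ≤ LinearMap.ker g' := by
    intro f hf
    have hf' : f ∈ Submodule.span Rᵐᵒᵖ (G : Set (Fin p → R)) := by rw [hG]; exact hf
    clear hf
    induction hf' using Submodule.span_induction with
    | mem f hf =>
      have h1 := hg'A f (hd f hf)
      have h2 : π f = 0 := by
        have : f ∈ LinearMap.ker π := hG ▸ Submodule.subset_span hf
        exact this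
      rw [h2] at h1
      exact Prod.ext (Subtype.ext h1.1) h1.2
    | zero => exact zero_mem _
    | add f f' _ _ h h' => exact add_mem h h'
    | smul s f _ h =>
      have h' : g' f = 0 := h
      rw [LinearMap.mem_ker, ← MulOpposite.op_unop s, hg'smul, h', map_zero]
  obtain ⟨g, hg⟩ : ∃ g : M →ₗ[Φ] A × R, ∀ f, g (π f) = g' f := by
    refine ⟨(LinearMap.ker (π.restrictScalars Φ)).liftQ g' hkerle ∘ₗ
      ((π.restrictScalars Φ).quotKerEquivOfSurjective hπ).symm.toLinearMap, fun f => ?_⟩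
    have : ((π.restrictScalars Φ).quotKerEquivOfSurjective hπ).symm (π f) =
        Submodule.Quotient.mk f := by
      rw [LinearEquiv.symm_apply_eq]; rfl
    rw [LinearMap.comp_apply, LinearEquiv.coe_coe, this]
    rfl
  have hgsmul : ∀ (m : M) (s : R), g (MulOpposite.op s • m) = (ρ s).unop (g m) := by
    intro m s
    obtain ⟨f, rfl⟩ := hπ m
    rw [← map_smul, hg, hg, hg'smul]
  have hgA : ∀ a : A, g a = (a, 0) := by
    rintro ⟨_, f, hf, rfl⟩
    have h := hg'A f fun i => hf i (Set.mem_univ i)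
    refine Prod.ext (Subtype.ext ?_) ?_
    · simpa [hg] using h.1
    · simpa [hg] using h.2
  have hgN : ∀ (m : M), (g m).1 = 0 → ∀ s : R,
      g (MulOpposite.op s • m) = (0, (g m).2 * s) := by
    intro m hm s
    rw [hgsmul, ← hρR', ← hm]
  -- The preimage of the submodule `R` of `A × R`; the quotient `M ⧸ N` embeds in `A`.
  let N : Submodule Rᵐᵒᵖ M :=
    { carrier := {m | (g m).1 = 0}
      add_mem' := fun {a b} ha hb => by
        simp only [Set.mem_ofPred_eq] at *
        simp [ha, hb]
      zero_mem' := by simp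
      smul_mem' := fun s m hm => by
        simp only [Set.mem_ofPred_eq] at *
        rw [← MulOpposite.op_unop s, hgN m hm] }
  let F : N →ₗ[Rᵐᵒᵖ] R :=
    { toFun := fun m => (g m).2
      map_add' := fun a b => by simp
      map_smul' := fun s m => by
        have := hgN m m.2 s.unop
        simp only [MulOpposite.op_unop] at this
        simp [this, MulOpposite.smul_eq_mul_unop] }
  refine ⟨N, ?_, F, ?_⟩
  · let h : M →ₗ[Φ] A := LinearMap.fst Φ A R ∘ₗ g
    have hN : N.restrictScalars Φ = LinearMap.ker h := rfl
    have : FiniteDimensional Φ (M ⧸ N.restrictScalars Φ) := by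
      rw [hN]
      exact Module.Finite.equiv h.quotKerEquivRange.symm
    exact Module.Finite.equiv (Submodule.Quotient.restrictScalarsEquiv Φ N)
  · intro t
    let b : A := ((ρ s₀).unop (a₀, 0)).1
    -- Since `g` is the identity on `A`, subtracting the `A`-component `b` leaves the generator `(0,
    -- 1)` of the free part.
    let m : M := MulOpposite.op s₀ • (a₀ : M) - b
    have hm : g m = (0, 1) := by
      simp only [m, map_sub, hgsmul, hgA]
      exact Prod.ext (by simp [b]) (by simp [h₀])
    have hmN : m ∈ N := by
      change (g m).1 = 0
      rw [hm]
    refine ⟨MulOpposite.op t • ⟨m, hmN⟩, ?_⟩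
    have := hgN m hmN t
    change (g (MulOpposite.op t • m)).2 = t
    simp [this, hm]

end

/-! ### Fox derivatives and partial actions for the two kinds of algebra -/

section

variable {Φ : Type*} [Field Φ]

/-- An injective partial endomorphism of a finite-dimensional space extends to an
automorphism. -/
lemma exists_linearEquiv_extending {A : Type*} [AddCommGroup A] [Module Φ A]
    [FiniteDimensional Φ A] {D : Submodule Φ A} (f : D →ₗ[Φ] A) (hf : Function.Injective f) :
    ∃ T : A ≃ₗ[Φ] A, ∀ d : D, T d = f d := by
  obtain ⟨C, hC⟩ := D.exists_isCompl
  obtain ⟨C', hC'⟩ := (LinearMap.range f).exists_isCompl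
  have h1 := Submodule.finrank_add_eq_of_isCompl hC
  have h2 := Submodule.finrank_add_eq_of_isCompl hC'
  rw [LinearMap.finrank_range_of_inj hf] at h2
  -- Injectivity gives `D` and its image equal dimension, so their complements have equal dimension
  -- too.
  let e : C ≃ₗ[Φ] C' := LinearEquiv.ofFinrankEq C C' (by omega)
  refine ⟨(Submodule.prodEquivOfIsCompl D C hC).symm ≪≫ₗ
    ((LinearEquiv.ofInjective f hf).prodCongr e) ≪≫ₗ Submodule.prodEquivOfIsCompl _ C' hC',
    fun d => ?_⟩
  simp

variable {R : Type*} [Ring R] [Algebra Φ R]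

section

variable {A : Type*} [AddCommGroup A] [Module Φ A]

/-- The endomorphism `(a, s) ↦ (T a, f a + s x)` of `A × R`. -/
def shear (T : Module.End Φ A) (f : A →ₗ[Φ] R) (x : R) : Module.End Φ (A × R) :=
  (T ∘ₗ LinearMap.fst Φ A R).prod (f ∘ₗ LinearMap.fst Φ A R +
    LinearMap.mulRight Φ x ∘ₗ LinearMap.snd Φ A R)

@[simp]
lemma shear_apply (T : Module.End Φ A) (f : A →ₗ[Φ] R) (x : R) (a : A) (s : R) :
    shear T f x (a, s) = (T a, f a + s * x) := rfl

/-- The invertible endomorphism `(a, s) ↦ (T a, f a + s x)` of `A × R`, acting on the right. -/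
def shearUnit (T : A ≃ₗ[Φ] A) (f : A →ₗ[Φ] R) (x : Rˣ) : ((Module.End Φ (A × R))ᵐᵒᵖ)ˣ where
  val := MulOpposite.op (shear T.toLinearMap f x)
  inv := MulOpposite.op (shear T.symm.toLinearMap
    (-(LinearMap.mulRight Φ (↑x⁻¹ : R) ∘ₗ f ∘ₗ T.symm.toLinearMap)) (↑x⁻¹ : R))
  val_inv := by
    apply MulOpposite.unop_injective
    refine LinearMap.ext fun y => ?_
    obtain ⟨a, s⟩ := y
    simp [add_mul]
  inv_val := by
    apply MulOpposite.unop_injective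
    refine LinearMap.ext fun y => ?_
    obtain ⟨a, s⟩ := y
    simp [add_mul]

end

/-- Fox derivatives from right actions of `R` on `Φ × R`. -/
lemma nonempty_foxDerivatives {ε : R →ₐ[Φ] Φ} {r : ℕ} {L : Set R} (hL : Algebra.adjoin Φ L = ⊤)
    (ρ : Fin r → R →ₐ[Φ] (Module.End Φ (Φ × R))ᵐᵒᵖ)
    (hε : ∀ i, ∀ s ∈ L, ∀ (c : Φ) (t : R), ((ρ i s).unop (c, t)).1 = ε s * c)
    (hρ : ∀ i, ∀ s ∈ L, ∀ t : R, (ρ i s).unop (0, t) = (0, t * s))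
    (y : Fin r → R) (hy : ∀ i, ε (y i) = 0)
    (hρy : ∀ i j, ((ρ i (y j)).unop (1, 0)).2 = if i = j then 1 else 0) :
    Nonempty (FoxDerivatives ε r) := by
  have hε' : ∀ i s, ∀ (c : Φ) (t : R), ((ρ i s).unop (c, t)).1 = ε s * c := by
    intro i s
    have hs : s ∈ Algebra.adjoin Φ L := hL ▸ Algebra.mem_top
    induction hs using Algebra.adjoin_induction with
    | mem x hx => exact hε i x hx
    | algebraMap c =>
      intro c' t
      simp [Algebra.algebraMap_eq_smul_one]
    | add x y _ _ hx hy =>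
      intro c t
      simp [hx, hy, add_mul]
    | mul x y _ _ hx hy =>
      intro c t
      simp only [map_mul, MulOpposite.unop_mul, Module.End.mul_apply]
      rw [show (ρ i x).unop (c, t) = (ε x * c, ((ρ i x).unop (c, t)).2) from
        Prod.ext (hx c t) rfl, hy]
      ring
  refine ⟨⟨fun i => LinearMap.snd Φ Φ R ∘ₗ
    { toFun := fun s => (ρ i s).unop (1, 0)
      map_add' := fun s t => by simp
      map_smul' := fun c s => by simp }, y, fun i s t => ?_, hρy, hy⟩⟩
  -- Here `(1, 0) s = (ε s, D i s)`. Acting by `t` as well, multiplicativity of the action becomes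
  -- the product rule.
  have h1 : (ρ i s).unop (1, 0) = ε s • ((1, 0) : Φ × R) + (0, ((ρ i s).unop (1, 0)).2) := by
    refine Prod.ext ?_ ?_
    · simp [hε']
    · simp
  simp only [LinearMap.comp_apply, LinearMap.coe_mk, AddHom.coe_mk, LinearMap.snd_apply, map_mul,
    MulOpposite.unop_mul, Module.End.mul_apply]
  conv_lhs => rw [h1, map_add, map_smul, unop_apply_zero_prod hL (hρ i)]
  simp [add_comm]

section

variable {r : ℕ} (e : FreeAlgebra Φ (Fin r) ≃ₐ[Φ] R)

lemma adjoin_range_of_freeAlgebra :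
    Algebra.adjoin Φ (Set.range fun i => e (FreeAlgebra.ι Φ i)) = ⊤ := by
  have := congrArg (Subalgebra.map (e : FreeAlgebra Φ (Fin r) →ₐ[Φ] R))
    (FreeAlgebra.adjoin_range_ι Φ (Fin r))
  rw [AlgHom.map_adjoin, ← Set.range_comp, Algebra.map_top] at this
  rw [eq_top_iff, ← (AlgHom.range_eq_top (e : FreeAlgebra Φ (Fin r) →ₐ[Φ] R)).2 e.surjective]
  exact this.ge

lemma exists_lift_of_freeAlgebra {E : Type*} [AddCommGroup E] [Module Φ E]
    (f : Fin r → Module.End Φ E) :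
    ∃ ρ : R →ₐ[Φ] (Module.End Φ E)ᵐᵒᵖ, ∀ i, (ρ (e (FreeAlgebra.ι Φ i))).unop = f i :=
  ⟨(FreeAlgebra.lift Φ fun i => MulOpposite.op (f i)).comp (e.symm : R →ₐ[Φ] _),
    fun i => by simp⟩

/-- For the `i`-th derivative, let `x j` send `(c, t)` to `(0, δ_ij c + t x j)`. Freeness permits
any such choice. -/
lemma nonempty_foxDerivatives_of_freeAlgebra {ε : R →ₐ[Φ] Φ}
    (hε : ∀ i, ε (e (FreeAlgebra.ι Φ i)) = 0) : Nonempty (FoxDerivatives ε r) := by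
  choose ρ hρ using fun i : Fin r => exists_lift_of_freeAlgebra e fun j =>
    shear (0 : Module.End Φ Φ) (if i = j then Algebra.linearMap Φ R else 0)
      (e (FreeAlgebra.ι Φ j))
  refine nonempty_foxDerivatives (adjoin_range_of_freeAlgebra e) ρ ?_ ?_
    (fun j => e (FreeAlgebra.ι Φ j)) hε ?_
  · rintro i _ ⟨j, rfl⟩ c t
    simp [hρ, hε]
  · rintro i _ ⟨j, rfl⟩ t
    simp [hρ]
  · intro i j
    rw [hρ]
    split_ifs <;> simp

variable {M : Type*} [AddCommGroup M] [Module Φ M] [Module Rᵐᵒᵖ M] [IsScalarTower Φ Rᵐᵒᵖ M]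

/-- The vectors of `A` that `x` keeps in `A`. -/
def partialDomain (A : Submodule Φ M) (x : R) : Submodule Φ A where
  carrier := {a | MulOpposite.op x • (a : M) ∈ A}
  add_mem' {a b} ha hb := by
    have := A.add_mem (show MulOpposite.op x • (a : M) ∈ A from ha) hb
    rwa [← smul_add] at this
  zero_mem' := by simp
  smul_mem' c a ha := by
    have := A.smul_mem c (show MulOpposite.op x • (a : M) ∈ A from ha)
    rwa [smul_comm] at this

/-- The partial action of `x` on `A`. -/
def partialAction (A : Submodule Φ M) (x : R) : partialDomain A x →ₗ[Φ] A where
  toFun a := ⟨MulOpposite.op x • ((a : A) : M), a.2⟩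
  map_add' a b := Subtype.ext (by simp)
  map_smul' c a := Subtype.ext (smul_comm _ _ _)

lemma exists_functional_of_notMem_partialDomain {A : Submodule Φ M} {x : R} {a : A}
    (ha : a ∉ partialDomain A x) :
    ∃ f : A →ₗ[Φ] R, f a = 1 ∧ ∀ b ∈ partialDomain A x, f b = 0 := by
  obtain ⟨g, hg, hle⟩ := Submodule.exists_le_ker_of_notMem ha
  refine ⟨Algebra.linearMap Φ R ∘ₗ ((g a)⁻¹ • g), by simp [hg], fun b hb => ?_⟩
  have : g b = 0 := hle hb
  simp [this]

/-- Free generators may act by arbitrary linear extensions of their partial actions. The one moving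
some `a₀` out of `A` also receives a component into `R` that is `1` at `a₀` and `0` wherever the
partial action is defined. -/
lemma extendsPartialActions_of_freeAlgebra :
    ExtendsPartialActions Φ R M (Set.range fun i => e (FreeAlgebra.ι Φ i)) := by
  classical
  rintro A - ⟨_, ⟨i₀, rfl⟩, a₀, ha₀, hnot⟩
  set x : Fin r → R := fun i => e (FreeAlgebra.ι Φ i) with hx
  obtain ⟨f, hf₀, hf⟩ := exists_functional_of_notMem_partialDomain (A := A) (x := x i₀)
    (a := ⟨a₀, ha₀⟩) hnot
  choose T hT using fun i => LinearMap.exists_extend (partialAction A (x i))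
  obtain ⟨ρ, hρ⟩ := exists_lift_of_freeAlgebra e fun j =>
    shear (T j) (if j = i₀ then f else 0) (x j)
  refine ⟨ρ, ?_, ?_, x i₀, ⟨a₀, ha₀⟩, ?_⟩
  · rintro _ ⟨i, rfl⟩ a ha
    have h1 : T i a = ⟨MulOpposite.op (x i) • (a : M), ha⟩ :=
      LinearMap.congr_fun (hT i) (⟨a, ha⟩ : partialDomain A (x i))
    refine ⟨by simp [hρ, h1, hx], ?_⟩
    rw [hρ]
    split_ifs with h
    · subst h
      simpa using hf a ha
    · simp
  · rintro _ ⟨i, rfl⟩ t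
    simp [hρ, hx]
  · simp [hx, hρ, hf₀]

end

section

variable {r : ℕ} (e : MonoidAlgebra Φ (FreeGroup (Fin r)) ≃ₐ[Φ] R)

/-- The group elements as units of an algebra isomorphic to the group algebra. -/
noncomputable def groupUnit : FreeGroup (Fin r) →* Rˣ :=
  ((e : MonoidAlgebra Φ (FreeGroup (Fin r)) →* R).comp
    (MonoidAlgebra.of Φ (FreeGroup (Fin r)))).toHomUnits

lemma coe_groupUnit (g : FreeGroup (Fin r)) :
    (groupUnit e g : R) = e (MonoidAlgebra.of Φ (FreeGroup (Fin r)) g) := rfl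

/-- The free generators and their inverses. -/
def groupLetters : Set R :=
  (Set.range fun i => (groupUnit e (FreeGroup.of i) : R)) ∪
    Set.range fun i => (↑(groupUnit e (FreeGroup.of i))⁻¹ : R)

lemma finite_groupLetters : (groupLetters e).Finite :=
  (Set.finite_range _).union (Set.finite_range _)

lemma adjoin_groupLetters : Algebra.adjoin Φ (groupLetters e) = ⊤ := by
  have hg : ∀ g, (groupUnit e g : R) ∈ Algebra.adjoin Φ (groupLetters e) := by
    intro g
    induction g using FreeGroup.induction_on with
    | C1 => simp
    | of i => exact Algebra.subset_adjoin (Or.inl ⟨i, rfl⟩)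
    | inv_of i _ => exact Algebra.subset_adjoin (Or.inr ⟨i, by simp⟩)
    | mul g h hg hh => rw [map_mul, Units.val_mul]; exact mul_mem hg hh
  refine eq_top_iff.2 fun s _ => ?_
  obtain ⟨t, rfl⟩ := e.surjective s
  induction t using MonoidAlgebra.induction_on with
  | of g => exact hg g
  | add a b ha hb => rw [map_add]; exact add_mem (ha trivial) (hb trivial)
  | smul c a ha => rw [map_smul]; exact Subalgebra.smul_mem _ (ha trivial) c

lemma exists_lift_of_groupAlgebra {E : Type*} [AddCommGroup E] [Module Φ E]
    (f : Fin r → ((Module.End Φ E)ᵐᵒᵖ)ˣ) :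
    ∃ ρ : R →ₐ[Φ] (Module.End Φ E)ᵐᵒᵖ,
      (∀ i, ρ (groupUnit e (FreeGroup.of i)) = f i) ∧
      ∀ i, ρ ↑(groupUnit e (FreeGroup.of i))⁻¹ = ↑(f i)⁻¹ := by
  refine ⟨(MonoidAlgebra.lift Φ _ _ ((Units.coeHom _).comp (FreeGroup.lift f))).comp
    (e.symm : R →ₐ[Φ] _), fun i => ?_, fun i => ?_⟩
  · simp [coe_groupUnit]
  · rw [← map_inv, coe_groupUnit]
    simp

/-- The dual elements are `x j - 1`. The group generators act unipotently, `(c, t) ↦ (c, δ_ij c + t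
x j)` up to the action on `R`, hence invertibly. -/
lemma nonempty_foxDerivatives_of_groupAlgebra {ε : R →ₐ[Φ] Φ}
    (hε : ∀ g, ε (groupUnit e g) = 1) : Nonempty (FoxDerivatives ε r) := by
  choose ρ hρ hρ' using fun i : Fin r => exists_lift_of_groupAlgebra e fun j =>
    shearUnit (LinearEquiv.refl Φ Φ) (if i = j then Algebra.linearMap Φ R else 0)
      (groupUnit e (FreeGroup.of j))
  refine nonempty_foxDerivatives (adjoin_groupLetters e) ρ ?_ ?_
    (fun j => groupUnit e (FreeGroup.of j) - 1) (fun j => by simp [hε]) ?_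
  · rintro i _ (⟨j, rfl⟩ | ⟨j, rfl⟩) c t
    · simp [hρ, hε, shearUnit]
    · have := hε (FreeGroup.of j)⁻¹
      rw [map_inv] at this
      simp only [hρ', this, shearUnit]
      simp
  · rintro i _ (⟨j, rfl⟩ | ⟨j, rfl⟩) t
    · simp [hρ, shearUnit]
    · simp only [hρ', shearUnit]
      simp
  · intro i j
    simp only [map_sub, hρ, map_one, shearUnit]
    split_ifs <;> simp

variable {M : Type*} [AddCommGroup M] [Module Φ M] [Module Rᵐᵒᵖ M] [IsScalarTower Φ Rᵐᵒᵖ M]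

/-- Generators must now act invertibly. Their partial actions are injective, so they extend to
automorphisms of `A`, and the block-triangular maps built from these are invertible. -/
lemma extendsPartialActions_of_groupAlgebra :
    ExtendsPartialActions Φ R M (groupLetters e) := by
  classical
  intro A hA hmove
  set x : Fin r → Rˣ := fun i => groupUnit e (FreeGroup.of i) with hx
  have hxinv : ∀ i (m : M), MulOpposite.op (x i : R) • MulOpposite.op (↑(x i)⁻¹ : R) • m = m := by
    intro i m
    rw [smul_smul, ← MulOpposite.op_mul, Units.inv_mul, MulOpposite.op_one, one_smul]
  have hinvx : ∀ i (m : M), MulOpposite.op (↑(x i)⁻¹ : R) • MulOpposite.op (x i : R) • m = m := by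
    intro i m
    rw [smul_smul, ← MulOpposite.op_mul, Units.mul_inv, MulOpposite.op_one, one_smul]
  have hinj : ∀ i, Function.Injective (partialAction A (x i : R)) := by
    intro i a b hab
    have h1 := congrArg (fun y : A => MulOpposite.op (↑(x i)⁻¹ : R) • (y : M)) hab
    simp only [partialAction, LinearMap.coe_mk, AddHom.coe_mk, hinvx] at h1
    exact Subtype.ext (Subtype.ext h1)
  choose T hT using fun i => exists_linearEquiv_extending (partialAction A (x i : R)) (hinj i)
  have hTx : ∀ i (a : A) (ha : MulOpposite.op (x i : R) • (a : M) ∈ A),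
      T i a = ⟨MulOpposite.op (x i : R) • (a : M), ha⟩ := fun i a ha =>
    hT i (⟨a, ha⟩ : partialDomain A (x i : R))
  obtain ⟨i₀, a₀, hnot⟩ : ∃ (i : Fin r) (a : A), a ∉ partialDomain A (x i : R) := by
    obtain ⟨_, ⟨i, rfl⟩ | ⟨i, rfl⟩, a, ha, hnot⟩ := hmove
    · exact ⟨i, ⟨a, ha⟩, hnot⟩
    -- If `x i` kept all of `A` in `A`, it would act there as the automorphism `T i`, so its inverse
    -- could not leave `A` either.
    · by_contra! hall
      refine hnot ?_
      have h1 := hTx i ((T i).symm ⟨a, ha⟩) (hall i _)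
      rw [LinearEquiv.apply_symm_apply] at h1
      have h2 : a = MulOpposite.op (x i : R) • (((T i).symm ⟨a, ha⟩ : A) : M) :=
        congrArg Subtype.val h1
      rw [h2, hinvx]
      exact Subtype.coe_prop _
  obtain ⟨f, hf₀, hf⟩ := exists_functional_of_notMem_partialDomain hnot
  obtain ⟨ρ, hρ, hρ'⟩ := exists_lift_of_groupAlgebra e fun j =>
    shearUnit (T j) (if j = i₀ then f else 0) (x j)
  have hmain : ∀ i (a : A) (ha : MulOpposite.op (x i : R) • (a : M) ∈ A),
      (ρ (x i)).unop (a, 0) = (⟨MulOpposite.op (x i : R) • (a : M), ha⟩, 0) := by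
    intro i a ha
    simp only [hx, hρ, shearUnit, MulOpposite.unop_op, shear_apply]
    refine Prod.ext (hTx i a ha) ?_
    split_ifs with h
    · subst h
      simpa using hf a ha
    · simp
  refine ⟨ρ, ?_, ?_, x i₀, a₀, ?_⟩
  · rintro _ (⟨i, rfl⟩ | ⟨i, rfl⟩) a ha
    · have := hmain i a ha
      simp only [hx] at this
      simp [this]
    -- The new action of `x i` sends `a (x i)⁻¹` to `a`; undoing it determines the action of the
    -- inverse letter on `a`.
    · have h1 := hmain i ⟨_, ha⟩ (by simp only; rw [hxinv]; exact a.2)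
      have h2 : (ρ ↑(x i)⁻¹).unop ((ρ (x i)).unop
          (⟨MulOpposite.op (↑(x i)⁻¹ : R) • (a : M), ha⟩, 0)) =
          (⟨MulOpposite.op (↑(x i)⁻¹ : R) • (a : M), ha⟩, 0) := by
        rw [← Module.End.mul_apply, ← MulOpposite.unop_mul, ← map_mul, Units.mul_inv, map_one]
        rfl
      rw [h1] at h2
      have h3 : (⟨MulOpposite.op (x i : R) • MulOpposite.op (↑(x i)⁻¹ : R) • (a : M),
          by rw [hxinv]; exact a.2⟩ : A) = a := Subtype.ext (hxinv i a)
      rw [h3] at h2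
      simp only [hx] at h2
      simp [h2]
  · rintro _ (⟨i, rfl⟩ | ⟨i, rfl⟩) t
    · simp [hρ, shearUnit, hx]
    · simp only [hρ', shearUnit]
      simp [hx]
  · simp [hx, hρ, hf₀, shearUnit]

end

end

/-! ### The induced filtration on modules, and powers of augmentation elements -/

namespace FoxDerivatives

section

variable {Φ R : Type*} [Field Φ] [Ring R] [Algebra Φ R] {ε : R →ₐ[Φ] Φ} {r : ℕ}
  (X : FoxDerivatives ε r)

/-- The vectors with all coordinates in the `n`-th term of the filtration. -/
def box (p n : ℕ) : Submodule Rᵐᵒᵖ (Fin p → R) where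
  carrier := {f | ∀ i, f i ∈ X.filtration n}
  add_mem' ha hb i := add_mem (ha i) (hb i)
  zero_mem' _ := zero_mem _
  smul_mem' s _ hf i := X.mul_mem_filtration_right (hf i) s.unop

/-- The quotient by the vectors with all coordinates in the `n`-th term of the filtration. -/
noncomputable def quotientBoxEquiv (p n : ℕ) :
    ((Fin p → R) ⧸ X.box p n) ≃ₗ[Φ] (Fin p → R ⧸ X.filtration n) := by
  let φ : (Fin p → R) →ₗ[Φ] (Fin p → R ⧸ X.filtration n) :=
    LinearMap.pi fun i => (X.filtration n).mkQ ∘ₗ LinearMap.proj i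
  have hφ : Function.Surjective φ := fun g => by
    choose s hs using fun i => Submodule.mkQ_surjective (X.filtration n) (g i)
    exact ⟨s, funext hs⟩
  have hker : (X.box p n).restrictScalars Φ = LinearMap.ker φ := by
    ext f
    simp [φ, box, funext_iff, Submodule.Quotient.mk_eq_zero]
  exact (Submodule.Quotient.restrictScalarsEquiv Φ _).symm.trans
    ((Submodule.quotEquivOfEq _ _ hker).trans (φ.quotKerEquivOfSurjective hφ))

instance finite_quotient_box (p n : ℕ) : FiniteDimensional Φ ((Fin p → R) ⧸ X.box p n) :=
  Module.Finite.equiv (X.quotientBoxEquiv p n).symm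

lemma finrank_quotient_box (p n : ℕ) :
    Module.finrank Φ ((Fin p → R) ⧸ X.box p n) = p * X.codim n := by
  simp [(X.quotientBoxEquiv p n).finrank_eq, codim, Module.finrank_pi_fintype]

variable {M : Type*} [AddCommGroup M] [Module Rᵐᵒᵖ M] {p : ℕ} (π : (Fin p → R) →ₗ[Rᵐᵒᵖ] M)

/-- The filtration on `M` induced by a map from a free module. -/
def moduleFiltration (n : ℕ) : Submodule Rᵐᵒᵖ M := (X.box p n).map π

lemma moduleFiltration_antitone : Antitone (X.moduleFiltration π) := fun _ _ h =>
  Submodule.map_mono fun _ hf i => X.filtration_antitone h (hf i)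

lemma op_smul_mem_moduleFiltration {d n : ℕ} {x : M} {s : R} (hx : x ∈ X.moduleFiltration π d)
    (hs : s ∈ X.filtration n) : MulOpposite.op s • x ∈ X.moduleFiltration π (d + n) := by
  obtain ⟨f, hf, rfl⟩ := hx
  exact ⟨MulOpposite.op s • f, fun i => X.mul_mem_filtration (hf i) hs, map_smul π _ _⟩

lemma op_smul_mem_moduleFiltration_of_surjective (hπ : Function.Surjective π) {n : ℕ} (x : M)
    {s : R} (hs : s ∈ X.filtration n) : MulOpposite.op s • x ∈ X.moduleFiltration π n := by
  obtain ⟨f, rfl⟩ := hπ x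
  have := X.op_smul_mem_moduleFiltration π (d := 0) (x := π f)
    ⟨f, fun i => X.mem_filtration_zero _, rfl⟩ hs
  rwa [zero_add] at this

/-- Powers of the elements of a finite-dimensional subspace of the augmentation ideal are
combinations of polynomially many elements. -/
lemma exists_pow_eq_sum {ℓ : ℕ} (v : Fin ℓ → R) (hv : ∀ i, ε (v i) = 0) (m : ℕ) :
    ∃ w : (Fin ℓ → Fin (m + 1)) → R, (∀ α, w α ∈ X.filtration m) ∧
      ∀ c : Fin ℓ → Φ, (∑ i, c i • v i) ^ m = ∑ α, (∏ i, c i ^ (α i : ℕ)) • w α := by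
  induction m with
  | zero =>
    exact ⟨fun _ => 1, fun _ => X.mem_filtration_zero _, fun c => by simp⟩
  | succ m ih =>
    obtain ⟨w, hw, hc⟩ := ih
    -- Raises the `i`-th exponent by one, which is multiplication of the monomial by `c i`.
    let shift (i : Fin ℓ) (α : Fin ℓ → Fin (m + 1)) : Fin ℓ → Fin (m + 1 + 1) := fun j =>
      if j = i then (α j).succ else (α j).castSucc
    have hshift : ∀ (c : Fin ℓ → Φ) i α,
        ∏ j, c j ^ (shift i α j : ℕ) = c i * ∏ j, c j ^ (α j : ℕ) := by
      intro c i α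
      have : ∀ j, c j ^ (shift i α j : ℕ) = (if j = i then c j else 1) * c j ^ (α j : ℕ) := by
        intro j
        by_cases h : j = i
        · simp [shift, h, pow_succ']
        · simp [shift, h]
      simp only [this, Finset.prod_mul_distrib, Finset.prod_ite_eq', Finset.mem_univ, if_true]
    refine ⟨fun β => ∑ i, ∑ α with shift i α = β, w α * v i, fun β => ?_, fun c => ?_⟩
    · exact sum_mem fun i _ => sum_mem fun α _ =>
        X.mul_mem_filtration (hw α) (X.mem_filtration_one.2 (hv i))
    · have h1 : ∀ i, ∑ β, (∏ j, c j ^ (β j : ℕ)) • ∑ α with shift i α = β, w α * v i =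
          ∑ α, (c i * ∏ j, c j ^ (α j : ℕ)) • (w α * v i) := by
        intro i
        simp only [Finset.smul_sum]
        rw [← Finset.sum_fiberwise Finset.univ (shift i)]
        refine Finset.sum_congr rfl fun β _ => Finset.sum_congr rfl fun α hα => ?_
        rw [← hshift, (Finset.mem_filter.1 hα).2]
      rw [pow_succ, hc]
      simp only [Finset.smul_sum (s := (Finset.univ : Finset (Fin ℓ)))]
      rw [Finset.sum_comm]
      simp only [h1]
      rw [Finset.sum_mul_sum, Finset.sum_comm]
      refine Finset.sum_congr rfl fun i _ => Finset.sum_congr rfl fun α _ => ?_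
      rw [smul_mul_smul_comm, mul_comm]

open Filter Topology in
lemma exists_mul_pow_le_mul_pow (hr : 1 < r) (k ℓ d : ℕ) {δ : ℝ} (hδ : 0 < δ) :
    ∃ m, d ≤ m ∧ (k : ℝ) * (m + 1) ^ ℓ ≤ δ * r ^ m := by
  have hr' : (1 : ℝ) < r := by exact_mod_cast hr
  -- The limit is taken along `m + 1`; the extra factor `r` turns `r ^ (m + 1)` back into `r ^ m`.
  have h1 := ((tendsto_pow_const_div_const_pow_of_one_lt ℓ hr').comp
    (tendsto_add_atTop_nat 1)).const_mul (k * r : ℝ)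
  rw [mul_zero] at h1
  obtain ⟨m, hm, hd⟩ := ((h1.eventually_lt_const hδ).and (eventually_ge_atTop d)).exists
  refine ⟨m, hd, ?_⟩
  have hpos : (0 : ℝ) < r ^ m := by positivity
  have hr0 : (r : ℝ) ≠ 0 := by positivity
  have h2 : (k * r : ℝ) * (((m + 1 : ℕ) : ℝ) ^ ℓ / (r : ℝ) ^ (m + 1)) =
      k * (m + 1) ^ ℓ / r ^ m := by
    push_cast
    rw [pow_succ]
    field_simp
  simp only [Function.comp_apply] at hm
  rw [h2, div_lt_iff₀ hpos] at hm
  exact hm.le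

end

end FoxDerivatives

/-! ### Dimension cost of adding relations -/

section

variable {Φ R : Type*} [Field Φ] [Ring R] [Algebra Φ R]
  {M : Type*} [AddCommGroup M] [Module Φ M] [Module Rᵐᵒᵖ M] [IsScalarTower Φ Rᵐᵒᵖ M]

/-- Adding one relation `v` to `M ⧸ P` lowers the dimension by at most the codimension of any
subspace annihilating `v` modulo `P`. -/
lemma finrank_quotient_le_sup_span_singleton (P : Submodule Rᵐᵒᵖ M) [FiniteDimensional Φ (M ⧸ P)]
    (J : Submodule Φ R) [FiniteDimensional Φ (R ⧸ J)] (v : M)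
    (hJ : ∀ s ∈ J, MulOpposite.op s • v ∈ P) :
    Module.finrank Φ (M ⧸ P) ≤
      Module.finrank Φ (M ⧸ (P ⊔ Submodule.span Rᵐᵒᵖ {v})) + Module.finrank Φ (R ⧸ J) := by
  -- This map factors through `R ⧸ J`, which bounds its range; the quotient of `M ⧸ P` by that range
  -- is an image of the new quotient.
  let φ : R →ₗ[Φ] M ⧸ P :=
    { toFun := fun s => Submodule.Quotient.mk (MulOpposite.op s • v)
      map_add' := fun s t => by simp [add_smul]
      map_smul' := fun c s => by simp }
  have hφ : J ≤ LinearMap.ker φ := fun s hs =>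
    (Submodule.Quotient.mk_eq_zero P).2 (hJ s hs)
  have h1 : Module.finrank Φ (LinearMap.range φ) ≤ Module.finrank Φ (R ⧸ J) := by
    rw [← J.range_liftQ φ hφ]
    exact LinearMap.finrank_range_le _
  have h2 := Submodule.finrank_quotient_add_finrank (LinearMap.range φ)
  let Q := P ⊔ Submodule.span Rᵐᵒᵖ {v}
  let ψ : M →ₗ[Φ] (M ⧸ P) ⧸ LinearMap.range φ :=
    (LinearMap.range φ).mkQ ∘ₗ (P.mkQ.restrictScalars Φ)
  have hψ : Q.restrictScalars Φ ≤ LinearMap.ker ψ := by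
    intro m hm
    obtain ⟨a, ha, b, hb, rfl⟩ := Submodule.mem_sup.1 ((Submodule.restrictScalars_mem _ _ _).1 hm)
    obtain ⟨s, rfl⟩ := Submodule.mem_span_singleton.1 hb
    have ha' : (Submodule.Quotient.mk a : M ⧸ P) = 0 := (Submodule.Quotient.mk_eq_zero P).2 ha
    have hb' : (Submodule.Quotient.mk (s • v) : M ⧸ P) ∈ LinearMap.range φ :=
      ⟨s.unop, by simp [φ]⟩
    simpa [ψ, ha', Submodule.Quotient.mk_eq_zero] using hb'
  have hsurj : Function.Surjective ψ :=
    (Submodule.mkQ_surjective _).comp (Submodule.mkQ_surjective P)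
  have hfin : FiniteDimensional Φ (M ⧸ Q.restrictScalars Φ) := by
    have hle : P.restrictScalars Φ ≤ Q.restrictScalars Φ := fun x hx =>
      Submodule.mem_sup_left hx
    have : FiniteDimensional Φ (M ⧸ P.restrictScalars Φ) :=
      Module.Finite.equiv (Submodule.Quotient.restrictScalarsEquiv Φ P).symm
    exact Module.Finite.of_surjective _ (Submodule.factor_surjective hle)
  have h3 : Module.finrank Φ ((M ⧸ P) ⧸ LinearMap.range φ) ≤
      Module.finrank Φ (M ⧸ Q.restrictScalars Φ) := by
    refine LinearMap.finrank_le_finrank_of_surjective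
      (f := (Q.restrictScalars Φ).liftQ ψ hψ) fun y => ?_
    obtain ⟨m, rfl⟩ := hsurj y
    exact ⟨Submodule.Quotient.mk m, rfl⟩
  rw [(Submodule.Quotient.restrictScalarsEquiv Φ Q).finrank_eq] at h3
  change _ ≤ Module.finrank Φ (M ⧸ Q) + _
  omega

lemma finiteDimensional_quotient_of_le {P Q : Submodule Rᵐᵒᵖ M} (h : P ≤ Q)
    [FiniteDimensional Φ (M ⧸ P)] : FiniteDimensional Φ (M ⧸ Q) :=
  Module.Finite.of_surjective ((Submodule.factor h).restrictScalars Φ)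
    (Submodule.factor_surjective h)

lemma finrank_quotient_le_of_le {P Q : Submodule Rᵐᵒᵖ M} (h : P ≤ Q)
    [FiniteDimensional Φ (M ⧸ P)] : Module.finrank Φ (M ⧸ Q) ≤ Module.finrank Φ (M ⧸ P) :=
  LinearMap.finrank_le_finrank_of_surjective (f := (Submodule.factor h).restrictScalars Φ)
    (Submodule.factor_surjective h)

/-- Adding finitely many relations. -/
lemma finrank_quotient_le_sup_span_finset (P : Submodule Rᵐᵒᵖ M) [FiniteDimensional Φ (M ⧸ P)]
    (J : Submodule Φ R) [FiniteDimensional Φ (R ⧸ J)] (G : Finset M)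
    (hJ : ∀ v ∈ G, ∀ s ∈ J, MulOpposite.op s • v ∈ P) :
    Module.finrank Φ (M ⧸ P) ≤
      Module.finrank Φ (M ⧸ (P ⊔ Submodule.span Rᵐᵒᵖ (G : Set M))) +
        G.card * Module.finrank Φ (R ⧸ J) := by
  classical
  induction G using Finset.induction_on with
  | empty =>
    have : P ⊔ Submodule.span Rᵐᵒᵖ ((∅ : Finset M) : Set M) = P := by simp
    rw [this]
    exact Nat.le_add_right _ _
  | insert v G hv ih =>
    have h1 := ih fun w hw => hJ w (Finset.mem_insert_of_mem hw)
    have hle : P ≤ P ⊔ Submodule.span Rᵐᵒᵖ (G : Set M) := le_sup_left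
    have := finiteDimensional_quotient_of_le (Φ := Φ) hle
    have h2 := finrank_quotient_le_sup_span_singleton (Φ := Φ)
      (P ⊔ Submodule.span Rᵐᵒᵖ (G : Set M)) J v
      fun s hs => hle (hJ v (Finset.mem_insert_self v G) s hs)
    have h3 : P ⊔ Submodule.span Rᵐᵒᵖ ((insert v G : Finset M) : Set M) =
        P ⊔ Submodule.span Rᵐᵒᵖ (G : Set M) ⊔ Submodule.span Rᵐᵒᵖ {v} := by
      rw [Finset.coe_insert, Submodule.span_insert, sup_comm (Submodule.span Rᵐᵒᵖ {v}), sup_assoc]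
    rw [h3, Finset.card_insert_of_notMem hv, add_mul, one_mul]
    omega

namespace FoxDerivatives

variable {ε : R →ₐ[Φ] Φ} {r : ℕ} (X : FoxDerivatives ε r) {p : ℕ} (π : (Fin p → R) →ₗ[Rᵐᵒᵖ] M)

/-- The quotient of `M` by the `n`-th term, as a quotient of the free module. -/
noncomputable def quotientModuleFiltrationEquiv (hπ : Function.Surjective π) (n : ℕ) :
    ((Fin p → R) ⧸ (X.box p n ⊔ LinearMap.ker π)) ≃ₗ[Rᵐᵒᵖ] M ⧸ X.moduleFiltration π n := by
  let φ : (Fin p → R) →ₗ[Rᵐᵒᵖ] M ⧸ X.moduleFiltration π n := (X.moduleFiltration π n).mkQ ∘ₗ π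
  have hker : X.box p n ⊔ LinearMap.ker π = LinearMap.ker φ := by
    rw [LinearMap.ker_comp, Submodule.ker_mkQ, moduleFiltration, Submodule.comap_map_eq]
  exact (Submodule.quotEquivOfEq _ _ hker).trans
    (φ.quotKerEquivOfSurjective ((Submodule.mkQ_surjective _).comp hπ))

lemma finite_quotient_moduleFiltration (hπ : Function.Surjective π) (n : ℕ) :
    FiniteDimensional Φ (M ⧸ X.moduleFiltration π n) := by
  have := finiteDimensional_quotient_of_le (Φ := Φ)
    (le_sup_left : X.box p n ≤ X.box p n ⊔ LinearMap.ker π)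
  exact Module.Finite.equiv ((X.quotientModuleFiltrationEquiv π hπ n).restrictScalars Φ)

lemma finite_quotient_sup_moduleFiltration (hπ : Function.Surjective π) (N : Submodule Rᵐᵒᵖ M)
    (n : ℕ) : FiniteDimensional Φ (M ⧸ (N ⊔ X.moduleFiltration π n)) := by
  have := X.finite_quotient_moduleFiltration π hπ n
  exact finiteDimensional_quotient_of_le (le_sup_right : X.moduleFiltration π n ≤ _)

/-- The free module contributes `p * codim n`. Each relation removes at most `codim n`, being
annihilated by `filtration n` modulo the box because the filtration consists of left ideals as well.
-/
lemma codim_le_finrank_of_presentation (hπ : Function.Surjective π) {q : ℕ} (hpq : q < p)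
    (v : Fin q → Fin p → R) (hv : LinearMap.ker π = Submodule.span Rᵐᵒᵖ (Set.range v)) (n : ℕ) :
    X.codim n ≤ Module.finrank Φ (M ⧸ X.moduleFiltration π n) := by
  classical
  have h := finrank_quotient_le_sup_span_finset (Φ := Φ) (X.box p n) (X.filtration n)
    (Finset.univ.image v) fun w _ s hs i => X.mul_mem_filtration_left (w i) hs
  rw [Finset.coe_image, Finset.coe_univ, Set.image_univ, ← hv, finrank_quotient_box] at h
  rw [← ((X.quotientModuleFiltrationEquiv π hπ n).restrictScalars Φ).finrank_eq]
  have hcard : (Finset.univ.image v).card ≤ q := by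
    simpa using Finset.card_image_le (s := Finset.univ) (f := v)
  change p * X.codim n ≤ _ + _ * X.codim n at h
  nlinarith [Nat.mul_le_mul_right (X.codim n) hcard, Nat.mul_le_mul_right (X.codim n) hpq]

/-- One step of the construction of a nil quotient: finitely many relations lying deep in the
filtration kill `x uᵐ` for `x` and `u` in given finite-dimensional subspaces. -/
theorem exists_nil_step (hr : 1 < r) (hπ : Function.Surjective π) (N : Submodule Rᵐᵒᵖ M)
    (hN : N.FG) {a δ : ℝ} (hδ : 0 < δ)
    (ha : ∀ n, a * X.codim n ≤ Module.finrank Φ (M ⧸ (N ⊔ X.moduleFiltration π n)))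
    (E : Submodule Φ M) [FiniteDimensional Φ E] (V : Submodule Φ R) [FiniteDimensional Φ V]
    (hV : ∀ u ∈ V, ε u = 0) (d : ℕ) :
    ∃ N' : Submodule Rᵐᵒᵖ M, N ≤ N' ∧ N' ≤ N ⊔ X.moduleFiltration π d ∧ N'.FG ∧
      (∀ n, (a - δ) * X.codim n ≤ Module.finrank Φ (M ⧸ (N' ⊔ X.moduleFiltration π n))) ∧
      ∃ m : ℕ, ∀ x ∈ E, ∀ u ∈ V, MulOpposite.op (u ^ m) • x ∈ N' := by
  classical
  let bE := Module.finBasis Φ E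
  let bV := Module.finBasis Φ V
  set k := Module.finrank Φ E
  set ℓ := Module.finrank Φ V
  -- There will be at most `k * (m + 1) ^ ℓ` relations, each costing a fraction `1 / r ^ m` of
  -- `codim n`; `d ≤ m` puts them deep enough.
  obtain ⟨m, hdm, hm⟩ := exists_mul_pow_le_mul_pow hr k ℓ d hδ
  obtain ⟨w, hw, hpow⟩ := X.exists_pow_eq_sum (fun i => (bV i : R)) (fun i => hV _ (bV i).2) m
  let G : Finset M := Finset.univ.image
    fun y : Fin k × (Fin ℓ → Fin (m + 1)) => MulOpposite.op (w y.2) • (bE y.1 : M)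
  have hG : ∀ v ∈ G, v ∈ X.moduleFiltration π m := by
    intro v hv
    obtain ⟨y, _, rfl⟩ := Finset.mem_image.1 hv
    exact X.op_smul_mem_moduleFiltration_of_surjective π hπ _ (hw _)
  have hcard : G.card ≤ k * (m + 1) ^ ℓ := by
    refine Finset.card_image_le.trans ?_
    simp
  refine ⟨N ⊔ Submodule.span Rᵐᵒᵖ (G : Set M), le_sup_left, sup_le le_sup_left ?_,
    hN.sup ⟨G, rfl⟩, fun n => ?_, m, fun x hx u hu => ?_⟩
  · refine (Submodule.span_le.2 fun v hv => ?_).trans le_sup_right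
    exact X.moduleFiltration_antitone π hdm (hG v hv)
  · have := X.finite_quotient_sup_moduleFiltration π hπ N n
    -- For `n < m` the truncated index is `0`: the relations already vanish at level `n` and cost
    -- nothing.
    have h := finrank_quotient_le_sup_span_finset (Φ := Φ) (N ⊔ X.moduleFiltration π n)
      (X.filtration (n - m)) G fun v hv s hs =>
        le_sup_right (a := N) (X.moduleFiltration_antitone π (by omega : n ≤ m + (n - m))
          (X.op_smul_mem_moduleFiltration π (hG v hv) hs))
    rw [sup_right_comm] at h
    change _ ≤ _ + G.card * X.codim (n - m) at h
    have h2 : (G.card : ℝ) * X.codim (n - m) ≤ δ * X.codim n := by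
      have h3 : (X.codim (n - m) : ℝ) * r ^ m ≤ X.codim n := by
        exact_mod_cast X.codim_sub_mul_pow_le n m
      have h4 : (G.card : ℝ) ≤ δ * r ^ m := le_trans (by exact_mod_cast hcard) hm
      calc (G.card : ℝ) * X.codim (n - m) ≤ δ * r ^ m * X.codim (n - m) := by gcongr
        _ = δ * (X.codim (n - m) * r ^ m) := by ring
        _ ≤ δ * X.codim n := by gcongr
    have h5 : (Module.finrank Φ (M ⧸ (N ⊔ X.moduleFiltration π n)) : ℝ) ≤
        Module.finrank Φ (M ⧸ (N ⊔ Submodule.span Rᵐᵒᵖ (G : Set M) ⊔ X.moduleFiltration π n)) +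
          G.card * X.codim (n - m) := by exact_mod_cast h
    have h6 := ha n
    rw [sub_mul]
    linarith
  · have hx' : x = ∑ i, bE.repr ⟨x, hx⟩ i • (bE i : M) := by
      have := congrArg E.subtype (bE.sum_repr ⟨x, hx⟩)
      rw [map_sum] at this
      exact this.symm
    have hu' : u = ∑ i, bV.repr ⟨u, hu⟩ i • (bV i : R) := by
      have := congrArg V.subtype (bV.sum_repr ⟨u, hu⟩)
      rw [map_sum] at this
      exact this.symm
    refine (le_sup_right : Submodule.span Rᵐᵒᵖ (G : Set M) ≤ _) ?_
    rw [hu', hpow, hx', Finset.smul_sum]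
    refine sum_mem fun i _ => ?_
    rw [Finset.op_sum, Finset.sum_smul]
    refine sum_mem fun α _ => ?_
    rw [MulOpposite.op_smul, smul_assoc, ← smul_one_smul Rᵐᵒᵖ (bE.repr ⟨x, hx⟩ i) (bE i : M),
      smul_smul (MulOpposite.op (w α)), mul_smul_comm, mul_one, smul_assoc]
    refine Submodule.smul_of_tower_mem _ _ (Submodule.smul_of_tower_mem _ _
      (Submodule.subset_span ?_))
    exact Finset.mem_coe.2 (Finset.mem_image.2 ⟨(i, α), Finset.mem_univ _, rfl⟩)

end FoxDerivatives

end

/-! ### Iteration, the direct limit and the residually finite-dimensional quotient -/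

lemma exists_chain_of_step {α : Type*} (P : ℕ → α → Prop) (S : ℕ → α → α → Prop) (a₀ : α)
    (h₀ : P 0 a₀) (step : ∀ t a, P t a → ∃ b, P (t + 1) b ∧ S t a b) :
    ∃ f : ℕ → α, f 0 = a₀ ∧ ∀ t, P t (f t) ∧ S t (f t) (f (t + 1)) := by
  choose g hg using step
  let F : ∀ t, {a // P t a} := fun t =>
    Nat.rec ⟨a₀, h₀⟩ (fun t a => ⟨g t a.1 a.2, (hg t a.1 a.2).1⟩) t
  exact ⟨fun t => (F t).1, rfl, fun t => ⟨(F t).2, (hg t (F t).1 (F t).2).2⟩⟩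

lemma isNilModule_quotient {Φ R M : Type*} [Field Φ] [Ring R] [Algebra Φ R] [AddCommGroup M]
    [Module Rᵐᵒᵖ M] {ε : R →ₐ[Φ] Φ} (h : IsNilModule ε M) (L : Submodule Rᵐᵒᵖ M) :
    IsNilModule ε (M ⧸ L) := by
  intro x u hu
  obtain ⟨m, rfl⟩ := Submodule.mkQ_surjective _ x
  obtain ⟨n, hn⟩ := h m u hu
  exact ⟨n, by rw [← map_smul, hn, map_zero]⟩

section

variable {Φ R : Type*} [Field Φ] [Ring R] [Algebra Φ R]
  {M : Type*} [AddCommGroup M] [Module Φ M] [Module Rᵐᵒᵖ M] [IsScalarTower Φ Rᵐᵒᵖ M]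

/-- The quotient by the union of a chain of submodules is the direct limit of the quotients. -/
lemma isDirectLimit_iSup (N : ℕ →o Submodule Rᵐᵒᵖ M) :
    ∃ e : Module.DirectLimit (fun t => M ⧸ N t) (quotientSystem N) ≃ₗ[Rᵐᵒᵖ] (M ⧸ ⨆ t, N t),
      ∀ (t : ℕ) (x : M),
        e (Module.DirectLimit.of Rᵐᵒᵖ ℕ (fun t => M ⧸ N t) (quotientSystem N) t
          (Submodule.Quotient.mk x)) = Submodule.Quotient.mk x := by
  let φ : Module.DirectLimit (fun t => M ⧸ N t) (quotientSystem N) →ₗ[Rᵐᵒᵖ] (M ⧸ ⨆ t, N t) :=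
    Module.DirectLimit.lift Rᵐᵒᵖ ℕ (fun t => M ⧸ N t) (quotientSystem N)
      (fun t => Submodule.factor (le_iSup N t)) fun i j h x => by
        obtain ⟨m, rfl⟩ := Submodule.mkQ_surjective _ x
        rfl
  have hφ : ∀ (t : ℕ) (x : M),
      φ (Module.DirectLimit.of Rᵐᵒᵖ ℕ (fun t => M ⧸ N t) (quotientSystem N) t
        (Submodule.Quotient.mk x)) = Submodule.Quotient.mk x := by
    intro t x
    simp only [φ, Module.DirectLimit.lift_of]
    rfl
  refine ⟨LinearEquiv.ofBijective φ ⟨?_, ?_⟩, hφ⟩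
  · intro z z' hz
    obtain ⟨t, y, y', rfl, rfl⟩ := Module.DirectLimit.exists_of₂ z z'
    obtain ⟨x, rfl⟩ := Submodule.mkQ_surjective _ y
    obtain ⟨x', rfl⟩ := Submodule.mkQ_surjective _ y'
    have hx : x - x' ∈ ⨆ t, N t :=
      (Submodule.Quotient.eq _).1 ((hφ t x).symm.trans (hz.trans (hφ t x')))
    rw [Submodule.mem_iSup_of_directed _ N.monotone.directed_le] at hx
    obtain ⟨s, hs⟩ := hx
    have h1 : quotientSystem N t (max s t) (le_max_right s t) ((N t).mkQ x) =
        quotientSystem N t (max s t) (le_max_right s t) ((N t).mkQ x') :=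
      (Submodule.Quotient.eq _).2 (N.monotone (le_max_left s t) hs)
    rw [← Module.DirectLimit.of_f (hij := le_max_right s t), h1, Module.DirectLimit.of_f]
  · intro y
    obtain ⟨x, rfl⟩ := Submodule.mkQ_surjective _ y
    exact ⟨_, hφ 0 x⟩

/-- If the finite-dimensional quotients `M ⧸ Q n` have unbounded dimension, then `M ⧸ ⨅ n, Q n` is
infinite-dimensional. -/
lemma not_finiteDimensional_quotient_iInf (Q : ℕ → Submodule Rᵐᵒᵖ M)
    (hQ : ∀ d : ℕ, ∃ n, d < Module.finrank Φ (M ⧸ Q n)) :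
    ¬ FiniteDimensional Φ (M ⧸ ⨅ n, Q n) := by
  intro h
  obtain ⟨n, hn⟩ := hQ (Module.finrank Φ (M ⧸ ⨅ n, Q n))
  exact absurd hn (not_lt.2 (finrank_quotient_le_of_le (iInf_le Q n)))

lemma isResiduallyFiniteDimensional_quotient_iInf (Q : ℕ → Submodule Rᵐᵒᵖ M)
    (hQ : ∀ n, FiniteDimensional Φ (M ⧸ Q n)) :
    IsResiduallyFiniteDimensional Φ R (M ⧸ ⨅ n, Q n) := by
  intro x hx
  obtain ⟨m, rfl⟩ := Submodule.mkQ_surjective _ x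
  have hm : m ∉ ⨅ n, Q n := fun h => hx ((Submodule.Quotient.mk_eq_zero _).2 h)
  obtain ⟨n, hn⟩ : ∃ n, m ∉ Q n := by simpa using hm
  have h1 := hQ n
  refine ⟨(Q n).map (⨅ n, Q n).mkQ, ?_, fun h => hn ?_⟩
  · exact Module.Finite.equiv
      ((Submodule.quotientQuotientEquivQuotient _ _ (iInf_le Q n)).restrictScalars Φ).symm
  · obtain ⟨m', hm', h2⟩ := h
    have h3 := iInf_le Q n ((Submodule.Quotient.eq _).1 h2)
    simpa using sub_mem hm' h3

/-- A chain of finitely generated submodules whose union gives a nil quotient of `M`, with the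
dimensions of the quotients under control. -/
theorem exists_nil_chain {r p q : ℕ} (hr : 1 < r) (hpq : q < p) {ε : R →ₐ[Φ] Φ}
    (X : FoxDerivatives ε r) {L : Set R} (hLfin : L.Finite) (hL : Algebra.adjoin Φ L = ⊤)
    (π : (Fin p → R) →ₗ[Rᵐᵒᵖ] M) (hπ : Function.Surjective π) (v : Fin q → Fin p → R)
    (hv : LinearMap.ker π = Submodule.span Rᵐᵒᵖ (Set.range v)) :
    ∃ N : ℕ →o Submodule Rᵐᵒᵖ M, N 0 = ⊥ ∧ (∀ t, (N t).FG) ∧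
      (∀ t n, X.codim n ≤ 2 * Module.finrank Φ (M ⧸ (N t ⊔ X.moduleFiltration π n))) ∧
      (∀ n, (⨆ t, N t) ⊔ X.moduleFiltration π n = N n ⊔ X.moduleFiltration π n) ∧
      ∀ (x : M) (u : R), ε u = 0 → ∃ t n : ℕ, MulOpposite.op (u ^ n) • x ∈ N t := by
  let W : ℕ → Submodule Φ R := fun n => (1 ⊔ Submodule.span Φ L) ^ n
  have hWmono : Monotone W := pow_right_monotone le_sup_left
  have hWfg : ∀ n, (W n).FG := finite_one_sup_span_pow hLfin
  -- The density starts at `1`, loses `(1 / 2) ^ (t + 2)` at step `t`, and never falls below `1 /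
  -- 2`.
  let a : ℕ → ℝ := fun t => 1 / 2 + (1 / 2) ^ (t + 1)
  have ha : ∀ t, 1 / 2 ≤ a t := fun t => by
    have : (0 : ℝ) < (1 / 2) ^ (t + 1) := by positivity
    simp only [a]
    linarith
  obtain ⟨N, hN0, hN⟩ := exists_chain_of_step
    (fun t (N : Submodule Rᵐᵒᵖ M) => N.FG ∧
      ∀ n, a t * X.codim n ≤ Module.finrank Φ (M ⧸ (N ⊔ X.moduleFiltration π n)))
    (fun t N N' => N ≤ N' ∧ N' ≤ N ⊔ X.moduleFiltration π t ∧ ∃ m : ℕ,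
      ∀ x ∈ boxImage π (W t), ∀ u ∈ W t ⊓ LinearMap.ker ε.toLinearMap,
        MulOpposite.op (u ^ m) • x ∈ N')
    ⊥ ⟨Submodule.fg_bot, fun n => by
      have := X.codim_le_finrank_of_presentation π hπ hpq v hv n
      rw [bot_sup_eq]
      simp only [a]
      norm_num
      exact this⟩
    fun t N ⟨hfg, hdim⟩ => by
      have h1 := finite_boxImage π (hWfg t)
      have h2 : FiniteDimensional Φ (W t) := Module.Finite.iff_fg.2 (hWfg t)
      have h3 : FiniteDimensional Φ ↥(W t ⊓ LinearMap.ker ε.toLinearMap) :=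
        Submodule.finiteDimensional_of_le inf_le_left
      obtain ⟨N', h4, h5, h6, h7, h8⟩ := X.exists_nil_step π hr hπ N hfg
        (δ := (1 / 2) ^ (t + 2)) (by positivity) hdim (boxImage π (W t))
        (W t ⊓ LinearMap.ker ε.toLinearMap) (fun u hu => hu.2) t
      refine ⟨N', ⟨h6, fun n => ?_⟩, h4, h5, h8⟩
      have : a (t + 1) = a t - (1 / 2) ^ (t + 2) := by
        simp only [a]
        ring
      rw [this]
      exact h7 n
  have hmono : Monotone N := monotone_nat_of_le_succ fun t => (hN t).2.1
  refine ⟨⟨N, hmono⟩, hN0, fun t => (hN t).1.1, fun t n => ?_, fun n => ?_, fun x u hu => ?_⟩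
  · have h1 := (hN t).1.2 n
    have h2 := mul_le_mul_of_nonneg_right (ha t) (Nat.cast_nonneg (α := ℝ) (X.codim n))
    have h3 : (X.codim n : ℝ) ≤
        2 * Module.finrank Φ (M ⧸ (N t ⊔ X.moduleFiltration π n)) := by linarith
    exact_mod_cast h3
  -- From step `n` onwards all new relations are trivial modulo level `n`, so the chain is constant
  -- there.
  · refine le_antisymm (sup_le (iSup_le fun t => ?_) le_sup_right)
      (sup_le_sup_right (le_iSup N n) _)
    obtain h | h := le_total t n
    · exact (hmono h).trans le_sup_left
    · induction t, h using Nat.le_induction with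
      | base => exact le_sup_left
      | succ t h ih =>
        exact (hN t).2.2.1.trans (sup_le ih
          ((X.moduleFiltration_antitone π h).trans le_sup_right))
  · obtain ⟨f, rfl⟩ := hπ x
    choose deg hdeg using exists_mem_pow_of_adjoin_eq_top hL
    -- The finite-dimensional spaces treated at the successive steps exhaust `M` and the
    -- augmentation ideal; step `t` treats both `x` and `u`.
    let t := max (deg u) (Finset.univ.sup fun i => deg (f i))
    obtain ⟨n, hn⟩ := (hN t).2.2.2
    refine ⟨t + 1, n, hn _ (mem_boxImage fun i => hWmono ?_ (hdeg (f i))) u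
      ⟨hWmono (le_max_left _ _) (hdeg u), hu⟩⟩
    exact (Finset.le_sup (f := fun i => deg (f i)) (Finset.mem_univ i)).trans (le_max_right _ _)

/-- This makes every stage `M ⧸ N` finitely presented, as largeness requires: the kernel is the
preimage of `N`, an extension of `N` by the span of the original relations. -/
lemma fg_ker_mkQ_comp {p q : ℕ} {π : (Fin p → R) →ₗ[Rᵐᵒᵖ] M} (hπ : Function.Surjective π)
    {v : Fin q → Fin p → R} (hv : LinearMap.ker π = Submodule.span Rᵐᵒᵖ (Set.range v))
    {N : Submodule Rᵐᵒᵖ M} (hN : N.FG) : (LinearMap.ker (N.mkQ ∘ₗ π)).FG := by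
  rw [LinearMap.ker_comp, Submodule.ker_mkQ]
  refine Submodule.fg_of_fg_map_of_fg_inf_ker π ?_ ?_
  · rwa [Submodule.map_comap_eq_of_surjective hπ]
  · rw [inf_eq_right.2 (LinearMap.ker_le_comap π), hv]
    exact Submodule.fg_span (Set.finite_range v)

/-- If `M ⧸ (K ⊔ U n)` is finite-dimensional of unbounded dimension, then `M ⧸ K` has an
infinite-dimensional residually finite-dimensional quotient. -/
lemma exists_residuallyFiniteDimensional_quotient (K : Submodule Rᵐᵒᵖ M)
    (U : ℕ → Submodule Rᵐᵒᵖ M) (hfin : ∀ n, FiniteDimensional Φ (M ⧸ (K ⊔ U n)))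
    (hU : ∀ d : ℕ, ∃ n, d < Module.finrank Φ (M ⧸ (K ⊔ U n))) :
    ∃ L : Submodule Rᵐᵒᵖ (M ⧸ K), ¬ FiniteDimensional Φ ((M ⧸ K) ⧸ L) ∧
      IsResiduallyFiniteDimensional Φ R ((M ⧸ K) ⧸ L) := by
  have eQ : ∀ n, ((M ⧸ K) ⧸ (K ⊔ U n).map K.mkQ) ≃ₗ[Φ] M ⧸ (K ⊔ U n) := fun n =>
    (Submodule.quotientQuotientEquivQuotient _ _ le_sup_left).restrictScalars Φ
  refine ⟨⨅ n, (K ⊔ U n).map K.mkQ, not_finiteDimensional_quotient_iInf _ fun d => ?_,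
    isResiduallyFiniteDimensional_quotient_iInf _ fun n => ?_⟩
  · obtain ⟨n, hn⟩ := hU d
    exact ⟨n, by rwa [(eQ n).finrank_eq]⟩
  · have := hfin n
    exact Module.Finite.equiv (eQ n).symm

lemma not_finiteDimensional_of_quotient (L : Submodule Rᵐᵒᵖ M)
    (h : ¬ FiniteDimensional Φ (M ⧸ L)) : ¬ FiniteDimensional Φ M := fun _ =>
  h (Module.Finite.of_surjective (L.mkQ.restrictScalars Φ) L.mkQ_surjective)

/-- The conclusion for every augmented algebra with Fox derivatives over which partial actions of
generators extend. -/
theorem exists_nil_quotient {r p q : ℕ} (hr : 1 < r) (hpq : q < p) {ε : R →ₐ[Φ] Φ}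
    (X : FoxDerivatives ε r) {L : Set R} (hLfin : L.Finite) (hL : Algebra.adjoin Φ L = ⊤)
    (hext : ∀ N : Submodule Rᵐᵒᵖ M, ExtendsPartialActions Φ R (M ⧸ N) L)
    (hM : HasPresentation R M p q) :
    ∃ K : Submodule Rᵐᵒᵖ M,
      ¬ FiniteDimensional Φ (M ⧸ K) ∧
      Module.Finite Rᵐᵒᵖ (M ⧸ K) ∧
      IsNilModule ε (M ⧸ K) ∧
      IsDirectLimitOfLargeQuotients Φ K ∧
      ∃ L : Submodule Rᵐᵒᵖ (M ⧸ K),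
        ¬ FiniteDimensional Φ ((M ⧸ K) ⧸ L) ∧
        IsNilModule ε ((M ⧸ K) ⧸ L) ∧
        IsResiduallyFiniteDimensional Φ R ((M ⧸ K) ⧸ L) := by
  obtain ⟨π, v, hπ, hv⟩ := hM
  obtain ⟨N, hN0, hfg, hdim, hsup, hpow⟩ := exists_nil_chain hr hpq X hLfin hL π hπ v hv
  have hfinQ := X.finite_quotient_sup_moduleFiltration π hπ
  -- The bound comes from `n ≤ codim n`, with at least half of `codim n` surviving in each quotient.
  have hunbounded : ∀ t (d : ℕ), ∀ n, 2 * (d + 1) ≤ n →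
      d < Module.finrank Φ (M ⧸ (N t ⊔ X.moduleFiltration π n)) := by
    intro t d n hn
    have h1 := hdim t n
    have h2 := X.le_codim (by omega) n
    omega
  have hlarge : ∀ t, IsLargeModule Φ R (M ⧸ N t) := by
    intro t
    refine isLargeModule_of_finitelyPresented ((N t).mkQ ∘ₗ π)
      ((Submodule.mkQ_surjective _).comp hπ) (fg_ker_mkQ_comp hπ hv (hfg t)) hLfin hL
      (hext (N t)) fun h => ?_
    exact absurd (hunbounded t (Module.finrank Φ (M ⧸ N t)) _ le_rfl)
      (not_lt.2 (finrank_quotient_le_of_le le_sup_left))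
  have hnil : IsNilModule ε (M ⧸ ⨆ t, N t) := by
    intro x u hu
    obtain ⟨m, rfl⟩ := Submodule.mkQ_surjective _ x
    obtain ⟨t, n, hn⟩ := hpow m u hu
    exact ⟨n, (Submodule.Quotient.mk_eq_zero _).2 (le_iSup N t hn)⟩
  obtain ⟨L', hL', hres⟩ := exists_residuallyFiniteDimensional_quotient (Φ := Φ) (⨆ t, N t)
    (X.moduleFiltration π) (hfinQ _) fun d => ⟨2 * (d + 1), by
      rw [hsup]
      exact hunbounded _ d _ le_rfl⟩
  have hR : Module.Finite Rᵐᵒᵖ R := Module.Finite.equiv (MulOpposite.opLinearEquiv Rᵐᵒᵖ).symm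
  have hfinite : Module.Finite Rᵐᵒᵖ M := Module.Finite.of_surjective π hπ
  exact ⟨⨆ t, N t, not_finiteDimensional_of_quotient L' hL', inferInstance, hnil,
    ⟨N, hN0, hlarge, fun _ _ h => Submodule.factor_surjective (N.monotone h),
      isDirectLimit_iSup N⟩, L', hL', isNilModule_quotient hnil L', hres⟩

end

theorem mainTheorem2 {Φ : Type*} [Field Φ] (r p q : ℕ) (hr : 1 < r) (hpq : q < p)
    {R : Type*} [Ring R] [Algebra Φ R] (ε : R →ₐ[Φ] Φ)
    (hR : IsFreeAssociativeAlgebra r ε ∨ IsFreeGroupAlgebra r ε)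
    {M : Type*} [AddCommGroup M] [Module Φ M] [Module Rᵐᵒᵖ M] [IsScalarTower Φ Rᵐᵒᵖ M]
    (hM : HasPresentation R M p q) :
    ∃ K : Submodule Rᵐᵒᵖ M,
      ¬ FiniteDimensional Φ (M ⧸ K) ∧
      Module.Finite Rᵐᵒᵖ (M ⧸ K) ∧
      IsNilModule ε (M ⧸ K) ∧
      IsDirectLimitOfLargeQuotients Φ K ∧
      ∃ L : Submodule Rᵐᵒᵖ (M ⧸ K),
        ¬ FiniteDimensional Φ ((M ⧸ K) ⧸ L) ∧
        IsNilModule ε ((M ⧸ K) ⧸ L) ∧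
        IsResiduallyFiniteDimensional Φ R ((M ⧸ K) ⧸ L) := by
  obtain ⟨e, he⟩ | ⟨e, he⟩ := hR
  · obtain ⟨X⟩ := nonempty_foxDerivatives_of_freeAlgebra e (ε := ε) fun i => by
      simpa using AlgHom.congr_fun he (FreeAlgebra.ι Φ i)
    exact exists_nil_quotient hr hpq X (Set.finite_range _) (adjoin_range_of_freeAlgebra e)
      (fun N => extendsPartialActions_of_freeAlgebra e) hM
  · obtain ⟨X⟩ := nonempty_foxDerivatives_of_groupAlgebra e (ε := ε) fun g => by
      rw [coe_groupUnit]
      simpa using AlgHom.congr_fun he (MonoidAlgebra.of Φ _ g)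
    exact exists_nil_quotient hr hpq X (finite_groupLetters e) (adjoin_groupLetters e)
      (fun N => extendsPartialActions_of_groupAlgebra e) hM
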